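/- Let $G$ be a finite group with a supercharacter theory $S$: a partition $\mathcal X$ of the set $\mathrm{Irr}(G)$ of complex irreducible characters and a partition $\mathcal Y$ of $G$ such that $\{1\}\in\mathcal Y$, $|\mathcal X|=|\mathcal Y|$, and for each $X\in\mathcal X$ the character $\sigma_X=\sum_{\chi\in X}\chi(1)\chi$ (an $S$-character) is constant on each $Y\in\mathcal Y$ (an $S$-class). A subgroup of $G$ is called $S$-normal if it is a union of $S$-classes. For an $S$-normal subgroup $N$ let $\mathrm{Irr}(S\mid N)$ be the set of $S$-characters whose kernel does not contain $N$, let $$V(S\mid N)=\langle g\in G:\ \chi(g)\neq 0\text{ for some }\chi\in\mathrm{Irr}(S\mid N)\rangle,$$ and let $U(S\mid N)$ be the product of all $S$-normal subgroups $K$ of $G$ with $V(S\mid K)\le N$. For a normal subgroup $N$ of $G$, say that $S$ is a $\ast$-product over $N$ if there are a supercharacter theory $C$ of $N$ whose classes are invariant under conjugation by $G$, and a supercharacter theory $D$ of $G/N$, such that the $S$-classes are exactly the $C$-classes and the preimages in $G$ of the $D$-classes other than $\{1\}$. For normal subgroups $M\le N$ of $G$, say that $S$ is a $\Delta$-product over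 $M$ and $N$ if there are a supercharacter theory $C$ of $N$ whose classes are invariant under conjugation by $G$ and a supercharacter theory $D$ of $G/M$ such that $M$ is $C$-normal, $N/M$ is $D$-normal, the images in $N/M$ of the $C$-classes are exactly the $D$-classes contained in $N/M$, and the $S$-classes are exactly the $C$-classes and the preimages in $G$ of the $D$-classes outside $N/M$. (Being a $\Delta$-product over $M$ and $N$ includes the condition $M\le N$.) Let $H$ and $N$ be $S$-normal subgroups of $G$. Then 1. $H\le U(S\mid N)$ if and only if $S$ is a $\Delta$-product over $H$ and $N$; 2. $N=U(S\mid N)$ if and only if $S$ is a $\ast$-product over $N$. -/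

import Mathlib

/-- The set `Irr(G)` of complex irreducible characters of `G`, as functions `G → ℂ`.
For finite `G` every irreducible complex representation is finite-dimensional, hence isomorphic
to one on some `ℂⁿ`. -/
def Irr (G : Type*) [Group G] : Set (G → ℂ) :=
  {χ | ∃ (n : ℕ) (ρ : Representation ℂ G (Fin n → ℂ)), ρ.IsIrreducible ∧ ρ.character = χ}

/-- `σ_X = ∑_{χ ∈ X} χ(1) χ` for a set `X` of irreducible characters. -/
noncomputable def sigmaChar {G : Type*} [Group G] (X : Set (Irr G)) : G → ℂ :=
  fun g => ∑ᶠ χ ∈ X, (χ : G → ℂ) 1 * (χ : G → ℂ) g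

/-- The kernel `{g | χ(g) = χ(1)}` of a character `χ`. -/
def charKer {G : Type*} [Group G] (χ : G → ℂ) : Set G :=
  {g | χ g = χ 1}

/-- A supercharacter theory of a (finite) group `G`: a partition of `Irr(G)` and a partition of
`G` with equally many parts, `{1}` being a part of the latter, such that every `σ_X` is constant
on every part of the latter. -/
structure SupercharacterTheory (G : Type*) [Group G] where
  /-- the partition of `Irr(G)` -/
  charParts : Set (Set (Irr G))
  /-- the partition of `G` into superclasses -/
  superclasses : Set (Set G)
  charParts_isPartition : Setoid.IsPartition charParts
  superclasses_isPartition : Setoid.IsPartition superclasses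
  singleton_one_mem : {1} ∈ superclasses
  ncard_eq : charParts.ncard = superclasses.ncard
  constant : ∀ X ∈ charParts, ∀ K ∈ superclasses, ∀ g ∈ K, ∀ h ∈ K,
    sigmaChar X g = sigmaChar X h

namespace SupercharacterTheory

variable {G : Type*} [Group G]

/-- `Irr(S)`: the supercharacters of `S`. -/
def supercharacters (S : SupercharacterTheory G) : Set (G → ℂ) :=
  {σ | ∃ X ∈ S.charParts, σ = sigmaChar X}

/-- `N` is `S`-normal: it is a union of `S`-classes. -/
def IsNormal (S : SupercharacterTheory G) (N : Subgroup G) : Prop :=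
  ∃ 𝒦 ⊆ S.superclasses, (N : Set G) = ⋃₀ 𝒦

/-- `Irr(S | N)`: the supercharacters of `S` whose kernel does not contain `N`. -/
def supercharactersOver (S : SupercharacterTheory G) (N : Subgroup G) : Set (G → ℂ) :=
  {χ ∈ S.supercharacters | ¬ (N : Set G) ⊆ charKer χ}

/-- The vanishing-off subgroup `V(S | N)`. -/
def V (S : SupercharacterTheory G) (N : Subgroup G) : Subgroup G :=
  Subgroup.closure {g | ∃ χ ∈ S.supercharactersOver N, χ g ≠ 0}

/-- `U(S | N)`: the product of all `S`-normal subgroups `H` with `V(S | H) ≤ N`.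
For finite `G`, `S`-normal subgroups are normal, so their product is their join. -/
def U (S : SupercharacterTheory G) (N : Subgroup G) : Subgroup G :=
  sSup {H | S.IsNormal H ∧ S.V H ≤ N}

/-- A supercharacter theory of a subgroup `N` of `G` is `G`-invariant: its superclasses are
closed under `G`-conjugacy. -/
def IsInvariant {N : Subgroup G} (C : SupercharacterTheory N) : Prop :=
  ∀ K ∈ C.superclasses, ∀ n ∈ K, ∀ m : N, IsConj (n : G) (m : G) → m ∈ K

/-- `S = C ∗ D`, for supercharacter theories `C` of `N` and `D` of `G ⧸ N`, `C` being
`G`-invariant: the superclasses of `S` are those of `C` together with the preimages of the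
non-identity superclasses of `D` (a supercharacter theory of a finite group is determined by
its superclasses). -/
def IsStarProduct (S : SupercharacterTheory G) {N : Subgroup G} [N.Normal]
    (C : SupercharacterTheory N) (D : SupercharacterTheory (G ⧸ N)) : Prop :=
  IsInvariant C ∧
  S.superclasses =
    {K | ∃ L ∈ C.superclasses, K = Subtype.val '' L} ∪
    {K | ∃ L ∈ D.superclasses, L ≠ {1} ∧ K = (QuotientGroup.mk' N) ⁻¹' L}

/-- `S` is a `∗`-product over `N`. The factors are then determined: they are the restriction of
`S` to `N` and the deflation of `S` to `G ⧸ N`. -/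
def IsStarProductOver (S : SupercharacterTheory G) (N : Subgroup G) : Prop :=
  ∃ (_ : N.Normal) (C : SupercharacterTheory N) (D : SupercharacterTheory (G ⧸ N)),
    S.IsStarProduct C D

/-- `S = C Δ D`, for normal subgroups `M ≤ N` and supercharacter theories `C` of `N` and `D` of
`G ⧸ M`, where `C` is `G`-invariant, `M` is `C`-normal, `N / M` is `D`-normal, and the deflation
of `C` to `N / M` agrees with the restriction of `D` to `N / M`: the superclasses of `S` are
those of `C` together with the preimages of the superclasses of `D` lying outside `N / M`. -/
def IsDeltaProduct (S : SupercharacterTheory G) {M N : Subgroup G} [M.Normal]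
    (C : SupercharacterTheory N) (D : SupercharacterTheory (G ⧸ M)) : Prop :=
  IsInvariant C ∧
  C.IsNormal (M.subgroupOf N) ∧
  D.IsNormal (N.map (QuotientGroup.mk' M)) ∧
  {L | ∃ K ∈ C.superclasses, L = (fun n : N => QuotientGroup.mk' M (n : G)) '' K} =
    {L ∈ D.superclasses | L ⊆ N.map (QuotientGroup.mk' M)} ∧
  S.superclasses =
    {K | ∃ L ∈ C.superclasses, K = Subtype.val '' L} ∪
    {K | ∃ L ∈ D.superclasses, Disjoint L (N.map (QuotientGroup.mk' M)) ∧
      K = (QuotientGroup.mk' M) ⁻¹' L}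

/-- `S` is a `Δ`-product over `M` and `N`. The factors are then determined: they are the
restriction of `S` to `N` and the deflation of `S` to `G ⧸ M`. -/
def IsDeltaProductOver (S : SupercharacterTheory G) (M N : Subgroup G) : Prop :=
  M ≤ N ∧ N.Normal ∧
    ∃ (_ : M.Normal) (C : SupercharacterTheory N) (D : SupercharacterTheory (G ⧸ M)),
      S.IsDeltaProduct C D

end SupercharacterTheory

/-!
A supercharacter theory `S` of `G` is encoded by the algebra `S.classFun` of functions that are
constant on superclasses. Schur's lemma, the orthogonality relations and the semisimplicity of `ℂ[G]`
identify the class functions of `G` under convolution with the functions on `Irr G` under pointwise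
multiplication (`centralChar`, `ofCentralChar`). Since there are as many parts of `Irr G` as
superclasses, this identification makes `S.classFun` correspond to the functions that are constant on
the parts of `Irr G` (`map_ofCentralChar`); in particular `S.classFun` is closed under convolution.
Conversely, a unital pointwise subalgebra of the class functions that contains the indicator function
of `{1}` and is closed under convolution is `T.classFun` for a supercharacter theory `T`
(`ofSubalgebra`), because a unital algebra of functions on a finite set consists of all functions
constant on the classes of a partition, with as many classes as its dimension. This produces the
restriction of `S` to an `S`-normal subgroup and the deflation of `S` to the quotient by one.

For an `S`-normal subgroup `H` with indicator function `1_H`, convolution with `1_H` acts on a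
supercharacter `σ` by a scalar `c` with `c² = |H| c`. So either `σ` is invariant under translation by
`H`, which happens exactly when `H ≤ ker σ`, or `1_H * σ = 0`. Both `S` being a Δ-product over `H`
and `N`, and `V(S | H) ≤ N`, are then equivalent to the condition that `H ≤ N` and every superclass
outside `N` is a union of cosets of `H` (`isDeltaProductOver_iff`, `V_le_iff_forall_mul_mem_cls`).
If `V(S | H) ≤ N` then for `x ∉ N` each supercharacter is either `H`-invariant or zero on `xH`, and
supercharacters separate superclasses. Conversely, if the superclass of `x` is a union of cosets then
`(1_H * σ)(x) = |H| σ(x)`, so that `σ(x) = 0` when `1_H * σ = 0`.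
Moreover `H ≤ U(S | N)` if and only if `V(S | H) ≤ N` (`le_U_iff`), and `H ≤ V(S | H)` (`le_V`), so
that `U(S | N) ≤ N`. The ∗-products over `N` are the Δ-products over `N` and `N`.
-/

/-! ### Algebras of functions on a finite set and partitions -/

/-- The algebra of complex functions that are constant on each member of `c`. -/
def constOn {I : Type*} (c : Set (Set I)) : Subalgebra ℂ (I → ℂ) where
  carrier := {f | ∀ K ∈ c, ∀ x ∈ K, ∀ y ∈ K, f x = f y}
  mul_mem' := by
    intro f g hf hg K hK x hx y hy
    simp [hf K hK x hx y hy, hg K hK x hx y hy]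
  add_mem' := by
    intro f g hf hg K hK x hx y hy
    simp [hf K hK x hx y hy, hg K hK x hx y hy]
  algebraMap_mem' := by
    intro a K hK x hx y hy
    simp [Pi.algebraMap_apply]

/-- The equivalence relation of not being separated by any function in `B`. -/
def sepSetoid {I : Type*} (B : Subalgebra ℂ (I → ℂ)) : Setoid I where
  r x y := ∀ f ∈ B, f x = f y
  iseqv := ⟨fun _ _ _ => rfl, fun h f hf => (h f hf).symm,
    fun h₁ h₂ f hf => (h₁ f hf).trans (h₂ f hf)⟩

lemma sepSetoid_rel {I : Type*} {B : Subalgebra ℂ (I → ℂ)} {x y : I} :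
    sepSetoid B x y ↔ ∀ f ∈ B, f x = f y := Iff.rfl

section

variable {I : Type*} {c : Set (Set I)}

lemma indicator_mem_constOn (hc : Setoid.IsPartition c) {K : Set I} (hK : K ∈ c) :
    K.indicator 1 ∈ constOn c := by
  intro L hL x hx y hy
  by_cases h : K = L
  · subst h; simp [hx, hy]
  · have hd : Disjoint K L := hc.pairwiseDisjoint hK hL h
    have hx' : x ∉ K := fun h' => Set.disjoint_left.1 hd h' hx
    have hy' : y ∉ K := fun h' => Set.disjoint_left.1 hd h' hy
    simp [hx', hy']

lemma mem_span_indicator [Finite I] (hc : Setoid.IsPartition c) {f : I → ℂ}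
    (hf : f ∈ constOn c) :
    f ∈ Submodule.span ℂ {g : I → ℂ | ∃ K ∈ c, g = K.indicator 1} := by
  classical
  have hfin : c.Finite := Set.toFinite _
  cases isEmpty_or_nonempty I
  · rw [Subsingleton.elim f 0]
    exact zero_mem _
  choose! r hr using fun K (hK : K ∈ c) => Setoid.nonempty_of_mem_partition hc hK
  have : f = ∑ K ∈ hfin.toFinset, f (r K) • K.indicator 1 := by
    ext x
    obtain ⟨K, ⟨hK, hx⟩, huniq⟩ := hc.2 x
    rw [Finset.sum_apply, Finset.sum_eq_single K]
    · simp [hx, hf K hK x hx (r K) (hr K hK)]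
    · intro L hL hne
      have : x ∉ L := fun h => hne (huniq L ⟨by simpa using hL, h⟩)
      simp [this]
    · intro h
      exact absurd hK (by simpa using h)
  rw [this]
  refine Submodule.sum_mem _ fun K hK => Submodule.smul_mem _ _ (Submodule.subset_span ?_)
  exact ⟨K, by simpa using hK, rfl⟩

lemma finrank_constOn [Finite I] (hc : Setoid.IsPartition c) :
    Module.finrank ℂ (constOn c) = c.ncard := by
  classical
  have hfin : Finite c := Set.toFinite c
  have := Fintype.ofFinite c
  choose r hr using fun K : c => Setoid.nonempty_of_mem_partition hc K.2
  choose p hp hpu using hc.2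
  let e : constOn c ≃ₗ[ℂ] (c → ℂ) :=
    { toFun := fun f K => f.1 (r K)
      map_add' := fun _ _ => rfl
      map_smul' := fun _ _ => rfl
      invFun := fun a => ⟨fun x => a ⟨p x, (hp x).1⟩, by
        intro K hK x hx y hy
        have h1 : p x = K := (hpu x K ⟨hK, hx⟩).symm
        have h2 : p y = K := (hpu y K ⟨hK, hy⟩).symm
        simp [h1, h2]⟩
      left_inv := by
        intro f
        ext x
        exact f.2 (p x) (hp x).1 _ (hr ⟨p x, (hp x).1⟩) _ (hp x).2
      right_inv := by
        intro a
        ext K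
        have : p (r K) = K := (hpu (r K) K ⟨K.2, hr K⟩).symm
        simp [this] }
  rw [e.finrank_eq, Module.finrank_fintype_fun_eq_card, ← Nat.card_eq_fintype_card,
    Nat.card_coe_set_eq]

/-- The indicator function of a class is a product of elements of `B`, each of which is `1` on the
class and vanishes at a prescribed point outside it. -/
lemma indicator_mem_of_mem_classes [Finite I] (B : Subalgebra ℂ (I → ℂ)) {K : Set I}
    (hK : K ∈ (sepSetoid B).classes) : K.indicator 1 ∈ B := by
  classical
  have := Fintype.ofFinite I
  obtain ⟨y, rfl⟩ := hK
  have key : ∀ z, ∃ f ∈ B, f y = 1 ∧ (¬ sepSetoid B z y → f z = 0) := by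
    intro z
    by_cases hz : sepSetoid B z y
    · exact ⟨1, one_mem B, rfl, fun h => absurd hz h⟩
    · have hz' := hz
      rw [sepSetoid_rel] at hz'
      push Not at hz'
      obtain ⟨f, hf, hne⟩ := hz'
      refine ⟨(f y - f z)⁻¹ • (f - algebraMap ℂ (I → ℂ) (f z)),
        B.smul_mem (sub_mem hf (B.algebraMap_mem _)) _, ?_, ?_⟩
      · have : f y - f z ≠ 0 := sub_ne_zero.2 (Ne.symm hne)
        simp [Pi.algebraMap_apply, this]
      · intro _
        simp [Pi.algebraMap_apply]
  choose f hfB hfy hfz using key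
  have hmem : ∏ z, f z ∈ B := prod_mem fun z _ => hfB z
  convert hmem using 1
  ext x
  by_cases hx : sepSetoid B x y
  · rw [Set.indicator_of_mem (by exact hx), sepSetoid_rel.1 hx _ hmem, Finset.prod_apply]
    simp [hfy]
  · rw [Set.indicator_of_notMem (by exact hx), Finset.prod_apply]
    exact (Finset.prod_eq_zero (f := fun z => f z x) (Finset.mem_univ x) (hfz x hx)).symm

/-- A unital subalgebra of `ℂ^I` is the algebra of functions constant on the classes of points it
does not separate. -/
lemma constOn_classes_sepSetoid [Finite I] (B : Subalgebra ℂ (I → ℂ)) :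
    constOn (sepSetoid B).classes = B := by
  apply le_antisymm
  · intro f hf
    have h := mem_span_indicator (Setoid.isPartition_classes _) hf
    have hle : Submodule.span ℂ {g : I → ℂ | ∃ K ∈ (sepSetoid B).classes, g = K.indicator 1} ≤
        Subalgebra.toSubmodule B := by
      rw [Submodule.span_le]
      rintro _ ⟨K, hK, rfl⟩
      exact indicator_mem_of_mem_classes B hK
    exact hle h
  · rintro f hf _ ⟨z, rfl⟩ x hx y hy
    exact (hx f hf).trans (hy f hf).symm

lemma sepSetoid_constOn_rel (hc : Setoid.IsPartition c) {K : Set I} (hK : K ∈ c) {x y : I}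
    (hx : x ∈ K) : sepSetoid (constOn c) x y ↔ y ∈ K := by
  refine ⟨fun h => ?_, fun hy f hf => hf K hK x hx y hy⟩
  by_contra hy
  have := h _ (indicator_mem_constOn hc hK)
  simp [hx, hy] at this

lemma classes_sepSetoid_constOn (hc : Setoid.IsPartition c) :
    (sepSetoid (constOn c)).classes = c := by
  have key : ∀ K ∈ c, ∀ y ∈ K, {x | sepSetoid (constOn c) x y} = K := by
    intro K hK y hy
    ext x
    rw [Set.mem_ofPred_eq, ← sepSetoid_constOn_rel hc hK hy]
    exact ⟨Setoid.symm' _, Setoid.symm' _⟩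
  ext K
  constructor
  · rintro ⟨y, rfl⟩
    obtain ⟨K, ⟨hK, hy⟩, -⟩ := hc.2 y
    rwa [key K hK y hy]
  · intro hK
    obtain ⟨y, hy⟩ := Setoid.nonempty_of_mem_partition hc hK
    exact ⟨y, (key K hK y hy).symm⟩

end

/-! ### Convolution and irreducible characters -/

open Representation in
lemma Representation.IsIrreducible.of_equiv {k G V W : Type*} [Field k] [Monoid G]
    [AddCommGroup V] [Module k V] [AddCommGroup W] [Module k W] {ρ : Representation k G V}
    {σ : Representation k G W} (e : ρ.Equiv σ) (hρ : ρ.IsIrreducible) : σ.IsIrreducible := by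
  rw [irreducible_iff_isSimpleModule_asModule] at hρ ⊢
  let f := IntertwiningMap.equivLinearMapAsModule ρ σ e.toIntertwiningMap
  have hf : Function.Bijective f := e.toLinearEquiv.bijective
  exact IsSimpleModule.congr (LinearEquiv.ofBijective f hf).symm

/-- The convolution product `(f * h)(x) = ∑_y f(y) h(y⁻¹x)` of functions on a finite group. -/
noncomputable def conv {G : Type*} [Group G] (f h : G → ℂ) : G → ℂ :=
  fun x => ∑ᶠ y, f y * h (y⁻¹ * x)

/-- `f` is a class function. -/
def IsClassFun {G : Type*} [Group G] (f : G → ℂ) : Prop :=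
  ∀ x y, f (y * x * y⁻¹) = f x

section

variable {G : Type*} [Group G]

lemma conv_apply [Fintype G] (f h : G → ℂ) (x : G) :
    conv f h x = ∑ y, f y * h (y⁻¹ * x) := finsum_eq_sum_of_fintype _

lemma IsClassFun.sub {f h : G → ℂ} (hf : IsClassFun f) (hh : IsClassFun h) :
    IsClassFun (f - h) := fun x y => by simp [hf x y, hh x y]

/-- Up to isomorphism, the representation space of a finite-dimensional representation is some
`ℂⁿ`, as in the definition of `Irr G`. -/
lemma character_mem_irr {V : Type*} [AddCommGroup V] [Module ℂ V] [FiniteDimensional ℂ V]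
    (ρ : Representation ℂ G V) (hρ : ρ.IsIrreducible) : ρ.character ∈ Irr G := by
  let e : V ≃ₗ[ℂ] (Fin (Module.finrank ℂ V) → ℂ) := (Module.finBasis ℂ V).equivFun
  let σ : Representation ℂ G (Fin (Module.finrank ℂ V) → ℂ) :=
    { toFun := fun g => e.conj (ρ g)
      map_one' := by ext; simp
      map_mul' := by intro x y; ext; simp [LinearEquiv.conj_apply] }
  let E : ρ.Equiv σ := Representation.Equiv.mk e (by
    intro g; ext v; simp [σ, LinearEquiv.conj_apply])
  exact ⟨_, σ, hρ.of_equiv E, (Representation.char_iso E).symm⟩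

lemma exists_irr_one_eq {χ : G → ℂ} (hχ : χ ∈ Irr G) : ∃ n : ℕ, 0 < n ∧ χ 1 = n := by
  obtain ⟨n, ρ, hρ, rfl⟩ := hχ
  have : Nontrivial (Fin n → ℂ) := by
    rw [Representation.irreducible_iff_isSimpleModule_asModule] at hρ
    exact IsSimpleModule.nontrivial (MonoidAlgebra ℂ G) ρ.asModule
  exact ⟨_, Module.finrank_pos, ρ.char_one⟩

lemma irr_one_ne_zero {χ : G → ℂ} (hχ : χ ∈ Irr G) : χ 1 ≠ 0 := by
  obtain ⟨n, hn, h⟩ := exists_irr_one_eq hχ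
  rw [h]
  exact_mod_cast hn.ne'

variable [Finite G]

lemma conv_add_left (f f' h : G → ℂ) : conv (f + f') h = conv f h + conv f' h := by
  have := Fintype.ofFinite G
  ext x
  simp [conv_apply, add_mul, Finset.sum_add_distrib]

lemma conv_add_right (f h h' : G → ℂ) : conv f (h + h') = conv f h + conv f h' := by
  have := Fintype.ofFinite G
  ext x
  simp [conv_apply, mul_add, Finset.sum_add_distrib]

lemma conv_smul_left (c : ℂ) (f h : G → ℂ) : conv (c • f) h = c • conv f h := by
  have := Fintype.ofFinite G
  ext x
  simp [conv_apply, mul_assoc, Finset.mul_sum]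

lemma conv_smul_right (c : ℂ) (f h : G → ℂ) : conv f (c • h) = c • conv f h := by
  have := Fintype.ofFinite G
  ext x
  simp [conv_apply, mul_left_comm, Finset.mul_sum]

lemma conv_assoc (f h k : G → ℂ) : conv (conv f h) k = conv f (conv h k) := by
  have := Fintype.ofFinite G
  ext x
  simp only [conv_apply, Finset.sum_mul, Finset.mul_sum]
  rw [Finset.sum_comm]
  refine Finset.sum_congr rfl fun y _ => ?_
  refine Fintype.sum_equiv (Equiv.mulLeft y⁻¹) _ _ fun z => ?_
  simp [mul_assoc]

/-- Convolution by a fixed function, as a linear map in the second argument. -/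
noncomputable def convLin (f : G → ℂ) : (G → ℂ) →ₗ[ℂ] (G → ℂ) where
  toFun := conv f
  map_add' := conv_add_right f
  map_smul' c h := conv_smul_right c f h

lemma indicator_singleton_one_conv (f : G → ℂ) : conv (({1} : Set G).indicator 1) f = f := by
  have := Fintype.ofFinite G
  ext x
  rw [conv_apply, Finset.sum_eq_single 1] <;> simp +contextual

lemma IsClassFun.conv {f h : G → ℂ} (hf : IsClassFun f) (hh : IsClassFun h) :
    IsClassFun (conv f h) := by
  have := Fintype.ofFinite G
  intro x y
  simp only [conv_apply]
  refine Fintype.sum_equiv (MulAut.conj y⁻¹).toEquiv _ _ fun z => ?_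
  simp only [MulEquiv.toEquiv_eq_coe, MulEquiv.coe_toEquiv, MulAut.conj_apply]
  rw [hf, ← hh ((y⁻¹ * z * y⁻¹⁻¹)⁻¹ * x) y]
  group

/-- Schur's lemma: for a class function `f` the operator `∑_y f(y⁻¹) ρ(y)` is a scalar, and
convolution with `f` multiplies the character of `ρ` by the same scalar. -/
lemma exists_conv_character_eq_smul {V : Type*} [AddCommGroup V] [Module ℂ V] [FiniteDimensional ℂ V]
    (ρ : Representation ℂ G V) (hρ : ρ.IsIrreducible) {f : G → ℂ} (hf : IsClassFun f) :
    ∃ c : ℂ,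
      (∀ v, ∑ᶠ y, f y⁻¹ • ρ y v = c • v) ∧ conv f ρ.character = c • ρ.character := by
  have := Fintype.ofFinite G
  let T : V →ₗ[ℂ] V := ∑ y, f y⁻¹ • ρ y
  have hT : ∀ g, T ∘ₗ ρ g = ρ g ∘ₗ T := by
    intro g
    ext v
    simp only [T, LinearMap.comp_apply, LinearMap.sum_apply, LinearMap.smul_apply, map_sum,
      map_smul]
    refine Fintype.sum_equiv (MulAut.conj g⁻¹).toEquiv _ _ fun y => ?_
    have h1 : f (g⁻¹ * y * g⁻¹⁻¹)⁻¹ = f y⁻¹ := by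
      rw [← hf y⁻¹ g⁻¹]; group
    have h2 : ρ g (ρ (g⁻¹ * y * g⁻¹⁻¹) v) = ρ y (ρ g v) := by
      rw [← Module.End.mul_apply, ← Module.End.mul_apply, ← map_mul, ← map_mul]; group
    simp only [MulEquiv.toEquiv_eq_coe, MulEquiv.coe_toEquiv, MulAut.conj_apply]
    rw [h1, h2]
  let F : Representation.IntertwiningMap ρ ρ := ⟨T, hT⟩
  obtain ⟨c, hc⟩ :=
    (Representation.IsIrreducible.algebraMap_intertwiningMap_bijective_of_isAlgClosed
      (ρ := ρ)).2 F
  have hTc : ∀ v, T v = c • v := by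
    intro v
    have : F v = (algebraMap ℂ (Representation.IntertwiningMap ρ ρ) c) v := by rw [hc]
    exact this.trans (by simp)
  refine ⟨c, fun v => ?_, ?_⟩
  · rw [← hTc v, finsum_eq_sum_of_fintype]
    simp [T]
  · ext x
    have h1 : LinearMap.trace ℂ V (T ∘ₗ ρ x) = c * ρ.character x := by
      have : T ∘ₗ ρ x = c • ρ x := by ext v; simp [hTc]
      rw [this]; simp [Representation.character]
    rw [conv_apply, Pi.smul_apply, smul_eq_mul, ← h1]
    have h2 : T ∘ₗ ρ x = ∑ y, f y⁻¹ • ρ (y * x) := by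
      ext v; simp [T]
    rw [h2, map_sum]
    refine Fintype.sum_equiv (Equiv.inv G) _ _ fun y => ?_
    simp [Representation.character]

/-- A class function all of whose scalars at irreducible characters vanish is zero, because
`ℂ[G]` is a sum of simple modules. -/
lemma eq_zero_of_conv_irr_eq_zero {f : G → ℂ} (hf : IsClassFun f)
    (h : ∀ χ ∈ Irr G, conv f χ = 0) : f = 0 := by
  classical
  have := Fintype.ofFinite G
  let a : MonoidAlgebra ℂ G := ∑ y, MonoidAlgebra.single y (f y⁻¹)
  have : NeZero (Nat.card G : ℂ) := ⟨by exact_mod_cast Nat.card_pos.ne'⟩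
  -- `a` acts on a simple left ideal by a scalar, which vanishes because `f` kills its character.
  have hsimple : ∀ M : Submodule (MonoidAlgebra ℂ G) (MonoidAlgebra ℂ G),
      IsSimpleModule (MonoidAlgebra ℂ G) M → ∀ v ∈ M, a * v = 0 := by
    intro M hM v hv
    let ρ : Representation ℂ G M := Representation.ofModule' M
    have hρ : ρ.asAlgebraHom = Algebra.lsmul ℂ ℂ M :=
      (MonoidAlgebra.lift ℂ (M →ₗ[ℂ] M) G).apply_symm_apply _
    have hirr : ρ.IsIrreducible := by
      rw [Representation.irreducible_iff_isSimpleModule_asModule]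
      let e : ρ.asModule ≃ₗ[MonoidAlgebra ℂ G] M :=
        { ρ.asModuleEquiv with
          map_smul' := fun r x => by
            change ρ.asModuleEquiv (r • x) = r • ρ.asModuleEquiv x
            rw [Representation.asModuleEquiv_map_smul, hρ]
            rfl }
      exact IsSimpleModule.congr e
    have : FiniteDimensional ℂ (MonoidAlgebra ℂ G) := inferInstance
    have : FiniteDimensional ℂ M :=
      inferInstanceAs (FiniteDimensional ℂ (M.restrictScalars ℂ))
    obtain ⟨c, hc, hcχ⟩ := exists_conv_character_eq_smul ρ hirr hf
    have hne := irr_one_ne_zero (character_mem_irr ρ hirr)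
    have hc0 : c = 0 := by
      have := congrFun (hcχ.symm.trans (h _ (character_mem_irr ρ hirr))) 1
      exact (mul_eq_zero.1 this).resolve_right hne
    have h2 := hc ⟨v, hv⟩
    rw [hc0, zero_smul, finsum_eq_sum_of_fintype] at h2
    have h3 := congrArg Subtype.val h2
    rw [AddSubmonoidClass.coe_finsetSum] at h3
    rw [Finset.sum_mul]
    refine Eq.trans (Finset.sum_congr rfl fun y _ => ?_) h3
    have h4 : ρ y ⟨v, hv⟩ = MonoidAlgebra.single y (1 : ℂ) • (⟨v, hv⟩ : M) := by
      rw [← Representation.asAlgebraHom_single_one, hρ]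
      rfl
    rw [h4, Submodule.coe_smul_of_tower, Submodule.coe_smul, smul_eq_mul, ← smul_mul_assoc,
      MonoidAlgebra.smul_single, smul_eq_mul, mul_one]
  -- The simple left ideals span `ℂ[G]`, so `a` annihilates `1`.
  have hall : a * 1 = 0 := by
    have h1 : (1 : MonoidAlgebra ℂ G) ∈ sSup {M : Submodule (MonoidAlgebra ℂ G)
        (MonoidAlgebra ℂ G) | IsSimpleModule (MonoidAlgebra ℂ G) M} := by
      rw [IsSemisimpleModule.sSup_simples_eq_top]; trivial
    rw [sSup_eq_iSup'] at h1
    refine Submodule.iSup_induction _ (motive := fun v => a * v = 0) h1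
      (fun M v hv => hsimple M.1 M.2 v hv) (mul_zero a) fun x y hx hy => ?_
    rw [mul_add, hx, hy, add_zero]
  rw [mul_one] at hall
  ext y
  have := congrArg (fun b : MonoidAlgebra ℂ G => b.coeff y⁻¹) hall
  simpa [a, Finsupp.single_apply] using this

lemma irr_isClassFun {G : Type*} [Group G] {χ : G → ℂ} (hχ : χ ∈ Irr G) : IsClassFun χ := by
  obtain ⟨n, ρ, -, rfl⟩ := hχ
  exact fun x y => ρ.char_conj x y

open Classical in
lemma irr_conv_one (χ ψ : Irr G) :
    conv (χ : G → ℂ) (ψ : G → ℂ) 1 = if χ = ψ then (Nat.card G : ℂ) else 0 := by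
  have := Fintype.ofFinite G
  obtain ⟨_, n, ρ, hρ, rfl⟩ := χ
  obtain ⟨_, m, σ, hσ, rfl⟩ := ψ
  have hG : (Nat.card G : ℂ) ≠ 0 := by exact_mod_cast Nat.card_pos.ne'
  have : Invertible (Nat.card G : ℂ) := invertibleOfNonzero hG
  have h1 := Representation.char_orthonormal ρ σ
  have h2 := Representation.char_orthonormal ρ ρ
  rw [if_pos ⟨.refl ρ⟩] at h2
  have h3 : ρ.character = σ.character ↔ Nonempty (σ.Equiv ρ) := by
    refine ⟨fun h => ?_, fun ⟨e⟩ => (Representation.char_iso e).symm⟩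
    by_contra hne
    rw [if_neg hne, ← h, h2] at h1
    exact one_ne_zero h1
  rw [inv_mul_eq_iff_eq_mul₀ hG] at h1
  simp only [conv_apply, mul_one]
  rw [h1]
  by_cases h : Nonempty (σ.Equiv ρ)
  · rw [if_pos h, if_pos (Subtype.ext (h3.2 h)), mul_one]
  · rw [if_neg h, if_neg fun h' => h (h3.1 (congrArg Subtype.val h')), mul_zero]

lemma linearIndependent_irr : LinearIndependent ℂ (fun χ : Irr G => (χ : G → ℂ)) := by
  classical
  rw [linearIndependent_iff']
  intro s g hg ψ hψ
  let L : (G → ℂ) →ₗ[ℂ] ℂ :=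
    { toFun := fun f => conv f ψ 1
      map_add' := fun f h => by rw [conv_add_left]; rfl
      map_smul' := fun c f => by rw [conv_smul_left]; rfl }
  have h2 := congrArg L hg
  rw [map_sum, map_zero] at h2
  simp only [map_smul] at h2
  have h3 : ∀ χ : Irr G, L χ = if χ = ψ then (Nat.card G : ℂ) else 0 := fun χ => irr_conv_one χ ψ
  simp only [h3, smul_eq_mul, mul_ite, mul_zero, Finset.sum_ite_eq', if_pos hψ] at h2
  have hG : (Nat.card G : ℂ) ≠ 0 := by exact_mod_cast Nat.card_pos.ne'
  exact (mul_eq_zero.1 h2).resolve_right hG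

instance finite_irr : Finite (Irr G) := linearIndependent_irr.finite

/-- The scalar by which convolution with the class function `f` acts on each irreducible character,
as a linear function of `f`. -/
noncomputable def centralChar : (G → ℂ) →ₗ[ℂ] (Irr G → ℂ) where
  toFun f χ := conv f χ 1 / (χ : G → ℂ) 1
  map_add' f h := by ext χ; simp [conv_add_left, add_div]
  map_smul' c f := by ext χ; simp [conv_smul_left, mul_div_assoc]

lemma centralChar_apply (f : G → ℂ) (χ : Irr G) :
    centralChar f χ = conv f χ 1 / (χ : G → ℂ) 1 := rfl

lemma conv_irr {f : G → ℂ} (hf : IsClassFun f) (χ : Irr G) :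
    conv f χ = centralChar f χ • (χ : G → ℂ) := by
  have h1 := irr_one_ne_zero χ.2
  obtain ⟨c, hc⟩ : ∃ c : ℂ, conv f χ = c • (χ : G → ℂ) := by
    obtain ⟨_, n, ρ, hρ, rfl⟩ := χ
    exact (exists_conv_character_eq_smul ρ hρ hf).imp fun _ h => h.2
  rw [centralChar_apply, hc, Pi.smul_apply, smul_eq_mul, mul_div_cancel_right₀ _ h1]

lemma centralChar_conv (f : G → ℂ) {h : G → ℂ} (hh : IsClassFun h) :
    centralChar (conv f h) = centralChar f * centralChar h := by
  ext χ
  rw [centralChar_apply, conv_assoc, conv_irr hh, conv_smul_right, Pi.mul_apply,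
    centralChar_apply f]
  simp only [Pi.smul_apply, smul_eq_mul]
  ring

lemma centralChar_indicator_singleton_one : centralChar (({1} : Set G).indicator 1) = 1 := by
  ext χ
  rw [centralChar_apply, indicator_singleton_one_conv, div_self (irr_one_ne_zero χ.2), Pi.one_apply]

/-- The class function with prescribed scalars on the irreducible characters: the combination of the
central idempotents `χ(1)χ/|G|` with the given coefficients. -/
noncomputable def ofCentralChar : (Irr G → ℂ) →ₗ[ℂ] (G → ℂ) where
  toFun p := ∑ᶠ χ : Irr G, (p χ * ((χ : G → ℂ) 1 / Nat.card G)) • (χ : G → ℂ)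
  map_add' p q := by
    have := Fintype.ofFinite (Irr G)
    simp only [finsum_eq_sum_of_fintype, Pi.add_apply, add_mul, add_smul, Finset.sum_add_distrib]
  map_smul' c p := by
    have := Fintype.ofFinite (Irr G)
    simp only [finsum_eq_sum_of_fintype, Pi.smul_apply, smul_eq_mul, mul_assoc, Finset.smul_sum,
      RingHom.id_apply, mul_smul]

lemma ofCentralChar_apply [Fintype (Irr G)] (p : Irr G → ℂ) :
    ofCentralChar p = ∑ χ : Irr G, (p χ * ((χ : G → ℂ) 1 / Nat.card G)) • (χ : G → ℂ) :=
  finsum_eq_sum_of_fintype _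

lemma isClassFun_ofCentralChar (p : Irr G → ℂ) : IsClassFun (ofCentralChar p) := by
  have := Fintype.ofFinite (Irr G)
  intro x y
  simp only [ofCentralChar_apply, Finset.sum_apply, Pi.smul_apply]
  exact Finset.sum_congr rfl fun χ _ => by rw [irr_isClassFun χ.2 x y]

lemma centralChar_ofCentralChar (p : Irr G → ℂ) : centralChar (ofCentralChar p) = p := by
  classical
  have := Fintype.ofFinite (Irr G)
  have hG : (Nat.card G : ℂ) ≠ 0 := by exact_mod_cast Nat.card_pos.ne'
  ext ψ
  have h1 := irr_one_ne_zero ψ.2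
  rw [ofCentralChar_apply, map_sum, Finset.sum_apply, Finset.sum_eq_single ψ]
  · rw [map_smul, Pi.smul_apply, centralChar_apply, irr_conv_one, if_pos rfl, smul_eq_mul]
    field_simp
  · intro χ _ hne
    rw [map_smul, Pi.smul_apply, centralChar_apply, irr_conv_one, if_neg hne]
    simp
  · simp

lemma ofCentralChar_centralChar {f : G → ℂ} (hf : IsClassFun f) :
    ofCentralChar (centralChar f) = f := by
  rw [eq_comm, ← sub_eq_zero]
  have hc := hf.sub (isClassFun_ofCentralChar (centralChar f))
  refine eq_zero_of_conv_irr_eq_zero hc fun χ hχ => ?_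
  rw [conv_irr hc ⟨χ, hχ⟩, map_sub, centralChar_ofCentralChar, sub_self, Pi.zero_apply, zero_smul]

lemma ofCentralChar_injective : Function.Injective (ofCentralChar (G := G)) :=
  Function.LeftInverse.injective centralChar_ofCentralChar

lemma sigmaChar_eq (X : Set (Irr G)) :
    sigmaChar X = (Nat.card G : ℂ) • ofCentralChar (X.indicator 1) := by
  classical
  have := Fintype.ofFinite (Irr G)
  have hG : (Nat.card G : ℂ) ≠ 0 := by exact_mod_cast Nat.card_pos.ne'
  ext g
  rw [sigmaChar, ofCentralChar_apply, Pi.smul_apply, Finset.sum_apply, Finset.smul_sum,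
    ← finsum_eq_sum_of_fintype]
  refine finsum_congr fun χ => ?_
  by_cases hχ : χ ∈ X
  · simp only [hχ, finsum_true, Pi.smul_apply, smul_eq_mul, Set.indicator_of_mem, Pi.one_apply]
    field_simp
  · simp [hχ]

lemma sigmaChar_one_ne_zero {X : Set (Irr G)} (hX : X.Nonempty) : sigmaChar X 1 ≠ 0 := by
  choose n hn hχn using fun χ : Irr G => exists_irr_one_eq χ.2
  have h1 : sigmaChar X 1 = ((∑ χ ∈ X.toFinite.toFinset, n χ * n χ : ℕ) : ℂ) := by
    rw [sigmaChar, finsum_mem_eq_finite_toFinset_sum _ X.toFinite]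
    simp [hχn]
  rw [h1, Nat.cast_ne_zero]
  obtain ⟨χ, hχ⟩ := hX
  refine (Finset.sum_pos (fun ψ _ => mul_pos (hn ψ) (hn ψ)) ⟨χ, ?_⟩).ne'
  simpa using hχ

end

/-! ### Supercharacter theories as algebras of functions -/

namespace SupercharacterTheory

/-- The algebra of functions that are constant on the superclasses. -/
def classFun {G : Type*} [Group G] (S : SupercharacterTheory G) : Subalgebra ℂ (G → ℂ) :=
  constOn S.superclasses

section

variable {G : Type*} [Group G] (S : SupercharacterTheory G)

/-- The superclass of `x`. -/
def cls (x : G) : Set G := {y | sepSetoid S.classFun y x}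

lemma mem_cls {x y : G} : y ∈ S.cls x ↔ ∀ f ∈ S.classFun, f y = f x := Iff.rfl

lemma mem_superclasses_iff {K : Set G} : K ∈ S.superclasses ↔ ∃ x, K = S.cls x := by
  change _ ↔ K ∈ (sepSetoid S.classFun).classes
  rw [classFun, classes_sepSetoid_constOn S.superclasses_isPartition]

lemma mem_cls_self (x : G) : x ∈ S.cls x := fun _ _ => rfl

lemma cls_eq {x y : G} (h : y ∈ S.cls x) : S.cls y = S.cls x := by
  ext z
  exact ⟨fun hz f hf => (hz f hf).trans (h f hf), fun hz f hf => (hz f hf).trans (h f hf).symm⟩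

lemma isNormal_iff {N : Subgroup G} :
    S.IsNormal N ↔ ∀ x ∈ N, ∀ y ∈ S.cls x, y ∈ N := by
  constructor
  · rintro ⟨c, hc, hN⟩ x hx y hy
    rw [← SetLike.mem_coe, hN] at hx ⊢
    obtain ⟨K, hK, hxK⟩ := hx
    obtain ⟨z, rfl⟩ := S.mem_superclasses_iff.1 (hc hK)
    refine ⟨_, hK, ?_⟩
    rwa [← S.cls_eq hxK]
  · intro h
    refine ⟨{K | ∃ x ∈ N, K = S.cls x}, ?_, ?_⟩
    · rintro _ ⟨x, -, rfl⟩
      exact S.mem_superclasses_iff.2 ⟨x, rfl⟩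
    · ext x
      constructor
      · intro hx
        exact ⟨_, ⟨x, hx, rfl⟩, S.mem_cls_self x⟩
      · rintro ⟨_, ⟨y, hy, rfl⟩, hx⟩
        exact h y hy x hx

lemma indicator_singleton_one_mem_classFun : ({1} : Set G).indicator 1 ∈ S.classFun :=
  indicator_mem_constOn S.superclasses_isPartition S.singleton_one_mem

lemma isNormal_iff_indicator_mem {N : Subgroup G} :
    S.IsNormal N ↔ (N : Set G).indicator 1 ∈ S.classFun := by
  rw [isNormal_iff]
  constructor
  · intro h K hK x hx y hy
    obtain ⟨z, rfl⟩ := S.mem_superclasses_iff.1 hK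
    have h1 : x ∈ N ↔ y ∈ N := by
      refine ⟨fun hxN => h x hxN y ?_, fun hyN => h y hyN x ?_⟩
      · rwa [S.cls_eq hx]
      · rwa [S.cls_eq hy]
    by_cases hxN : x ∈ N
    · simp [hxN, h1.1 hxN]
    · simp [hxN, mt h1.2 hxN]
  · intro h x hx y hy
    by_contra hyN
    have := hy _ h
    simp [hx, hyN] at this

lemma sigmaChar_mem_classFun {X : Set (Irr G)} (hX : X ∈ S.charParts) :
    sigmaChar X ∈ S.classFun := fun K hK g hg h hh => S.constant X hX K hK g hg h hh

variable [Finite G]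

/-- The isomorphism between functions on `Irr G` and class functions takes functions constant on the
parts of `Irr G` to functions constant on superclasses: one inclusion holds since each
`σ_X` is constant on superclasses, and the dimensions agree since `|𝒳| = |𝒴|`. -/
lemma map_ofCentralChar :
    (Subalgebra.toSubmodule (constOn S.charParts)).map ofCentralChar =
      Subalgebra.toSubmodule S.classFun := by
  have hG : (Nat.card G : ℂ) ≠ 0 := by exact_mod_cast Nat.card_pos.ne'
  refine Submodule.eq_of_le_of_finrank_eq ?_ ?_
  · rw [Submodule.map_le_iff_le_comap]
    intro p hp
    refine Submodule.span_le.2 ?_ (mem_span_indicator S.charParts_isPartition hp)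
    rintro _ ⟨X, hX, rfl⟩
    have h1 := S.sigmaChar_mem_classFun hX
    rw [sigmaChar_eq] at h1
    have h2 := S.classFun.smul_mem h1 (Nat.card G : ℂ)⁻¹
    rwa [inv_smul_smul₀ hG] at h2
  · rw [← (Submodule.equivMapOfInjective _ ofCentralChar_injective _).finrank_eq]
    exact (finrank_constOn S.charParts_isPartition).trans
      (S.ncard_eq.trans (finrank_constOn S.superclasses_isPartition).symm)

lemma mem_classFun_iff {f : G → ℂ} :
    f ∈ S.classFun ↔ IsClassFun f ∧ centralChar f ∈ constOn S.charParts := by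
  rw [← Subalgebra.mem_toSubmodule, ← map_ofCentralChar, Submodule.mem_map]
  constructor
  · rintro ⟨p, hp, rfl⟩
    refine ⟨isClassFun_ofCentralChar p, ?_⟩
    rwa [centralChar_ofCentralChar]
  · rintro ⟨hf, h⟩
    exact ⟨_, h, ofCentralChar_centralChar hf⟩

lemma isClassFun_of_mem {f : G → ℂ} (hf : f ∈ S.classFun) : IsClassFun f :=
  (S.mem_classFun_iff.1 hf).1

lemma conv_mem_classFun {f h : G → ℂ} (hf : f ∈ S.classFun) (hh : h ∈ S.classFun) :
    conv f h ∈ S.classFun := by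
  rw [mem_classFun_iff] at *
  have hc : centralChar (conv f h) ∈ constOn S.charParts := by
    rw [centralChar_conv f hh.1]
    exact mul_mem hf.2 hh.2
  exact ⟨hf.1.conv hh.1, hc⟩

/-- Convolution with a superclass function multiplies each supercharacter by a scalar. -/
lemma exists_conv_sigmaChar {f : G → ℂ} (hf : f ∈ S.classFun) {X : Set (Irr G)}
    (hX : X ∈ S.charParts) : ∃ c : ℂ, conv f (sigmaChar X) = c • sigmaChar X := by
  obtain ⟨hf1, hf2⟩ := S.mem_classFun_iff.1 hf
  obtain ⟨χ, hχ⟩ := Setoid.nonempty_of_mem_partition S.charParts_isPartition hX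
  refine ⟨centralChar f χ, ?_⟩
  have hσ : IsClassFun (sigmaChar X) := S.isClassFun_of_mem (S.sigmaChar_mem_classFun hX)
  rw [← ofCentralChar_centralChar (hf1.conv hσ), centralChar_conv f hσ, sigmaChar_eq, map_smul,
    centralChar_ofCentralChar, smul_comm, ← map_smul ofCentralChar, ← map_smul ofCentralChar]
  congr 1
  ext ψ
  by_cases hψ : ψ ∈ X
  · simp [hψ, hf2 X hX χ hχ ψ hψ, mul_comm]
  · simp [hψ]

end

/-- Every algebra of class functions under pointwise multiplication that contains the unit of
convolution and is closed under convolution comes from a supercharacter theory. Its image in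
the functions on `Irr G` is a subalgebra of the same dimension, so it has as many classes of
unseparated points. -/
def ofSubalgebra {G : Type*} [Group G] [Finite G] (B : Subalgebra ℂ (G → ℂ))
    (hcl : ∀ f ∈ B, IsClassFun f) (hone : ({1} : Set G).indicator 1 ∈ B)
    (hconv : ∀ f ∈ B, ∀ h ∈ B, conv f h ∈ B) : SupercharacterTheory G :=
  let A : Subalgebra ℂ (Irr G → ℂ) :=
    { carrier := centralChar '' B
      mul_mem' := by
        rintro _ _ ⟨f, hf, rfl⟩ ⟨h, hh, rfl⟩
        exact ⟨conv f h, hconv f hf h hh, centralChar_conv f (hcl h hh)⟩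
      add_mem' := by
        rintro _ _ ⟨f, hf, rfl⟩ ⟨h, hh, rfl⟩
        exact ⟨f + h, add_mem hf hh, map_add _ _ _⟩
      algebraMap_mem' := fun c => ⟨c • ({1} : Set G).indicator 1, B.smul_mem hone c, by
        rw [map_smul, centralChar_indicator_singleton_one, Algebra.algebraMap_eq_smul_one]⟩ }
  have hA : ∀ p ∈ A, ofCentralChar p ∈ B := by
    rintro _ ⟨f, hf, rfl⟩
    rwa [ofCentralChar_centralChar (hcl f hf)]
  { charParts := (sepSetoid A).classes
    superclasses := (sepSetoid B).classes
    charParts_isPartition := Setoid.isPartition_classes _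
    superclasses_isPartition := Setoid.isPartition_classes _
    singleton_one_mem := by
      refine ⟨1, ?_⟩
      ext x
      simp only [Set.mem_singleton_iff, Set.mem_ofPred_eq]
      constructor
      · rintro rfl
        exact Setoid.refl' _ _
      · intro h
        by_contra hne
        have := h _ hone
        simp [hne] at this
    ncard_eq := by
      rw [← finrank_constOn (Setoid.isPartition_classes _),
        ← finrank_constOn (Setoid.isPartition_classes _), constOn_classes_sepSetoid,
        constOn_classes_sepSetoid]
      let e : A ≃ₗ[ℂ] B :=
        { toFun := fun p => ⟨ofCentralChar p.1, hA p.1 p.2⟩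
          map_add' := fun p q => Subtype.ext (map_add ofCentralChar p.1 q.1)
          map_smul' := fun c p => Subtype.ext (map_smul ofCentralChar c p.1)
          invFun := fun f => ⟨centralChar f.1, f.1, f.2, rfl⟩
          left_inv := fun p => Subtype.ext (centralChar_ofCentralChar p.1)
          right_inv := fun f => Subtype.ext (ofCentralChar_centralChar (hcl f.1 f.2)) }
      exact e.finrank_eq
    constant := by
      intro X hX K hK g hg h hh
      have h1 : sigmaChar X ∈ B := by
        rw [sigmaChar_eq]
        exact B.smul_mem (hA _ (indicator_mem_of_mem_classes A hX)) _
      rw [← constOn_classes_sepSetoid B] at h1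
      exact h1 K hK g hg h hh }

section

variable {G : Type*} [Group G] [Finite G]

lemma classFun_ofSubalgebra (B : Subalgebra ℂ (G → ℂ))
    (hcl : ∀ f ∈ B, IsClassFun f) (hone : ({1} : Set G).indicator 1 ∈ B)
    (hconv : ∀ f ∈ B, ∀ h ∈ B, conv f h ∈ B) :
    (ofSubalgebra B hcl hone hconv).classFun = B := constOn_classes_sepSetoid B

variable (S : SupercharacterTheory G)

lemma indicator_cls_mem (x : G) : (S.cls x).indicator 1 ∈ S.classFun :=
  indicator_mem_of_mem_classes _ ⟨x, rfl⟩

lemma conj_mem_cls (x y : G) : y * x * y⁻¹ ∈ S.cls x :=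
  fun _ hf => S.isClassFun_of_mem hf x y

lemma IsNormal.normal {S : SupercharacterTheory G} {N : Subgroup G} (hN : S.IsNormal N) :
    N.Normal :=
  ⟨fun x hx y => S.isNormal_iff.1 hN x hx _ (S.conj_mem_cls x y)⟩

end

end SupercharacterTheory

/-! ### Averaging over a subgroup -/

section

variable {G : Type*} [Group G]

/-- Precomposition with `φ`, as a homomorphism of algebras of functions. -/
def compHom {I J : Type*} (φ : I → J) : (J → ℂ) →ₐ[ℂ] (I → ℂ) where
  toFun f := f ∘ φ
  map_one' := rfl
  map_mul' _ _ := rfl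
  map_zero' := rfl
  map_add' _ _ := rfl
  commutes' _ := rfl

lemma compHom_apply {I J : Type*} (φ : I → J) (f : J → ℂ) (x : I) :
    compHom φ f x = f (φ x) := rfl

lemma finsum_indicator_mul (H : Subgroup G) (F : G → ℂ) :
    ∑ᶠ y, (H : Set G).indicator 1 y * F y = ∑ᶠ y : H, F y := by
  classical
  rw [show (∑ᶠ y : H, F y) = ∑ᶠ y ∈ (H : Set G), F y from
    finsum_set_coe_eq_finsum_mem (f := F) (H : Set G), finsum_mem_def]
  refine finsum_congr fun y => ?_
  by_cases hy : y ∈ H <;> simp [hy]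

lemma conv_indicator_apply (H : Subgroup G) (f : G → ℂ) (x : G) :
    conv ((H : Set G).indicator 1) f x = ∑ᶠ h : H, f (h * x) := by
  rw [conv, finsum_indicator_mul H fun y => f (y⁻¹ * x)]
  exact finsum_comp_equiv (Equiv.inv H) (f := fun h : H => f (h * x))

/-- The group of left translations that leave `f` unchanged. -/
def leftPeriods (f : G → ℂ) : Subgroup G where
  carrier := {h | ∀ x, f (h * x) = f x}
  one_mem' := fun x => by rw [one_mul]
  mul_mem' := fun {a b} ha hb x => by rw [mul_assoc, ha, hb]
  inv_mem' := fun {a} ha x => by rw [← ha (a⁻¹ * x), mul_inv_cancel_left]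

lemma conv_indicator_eq_card_mul [Finite G] {H : Subgroup G} {f : G → ℂ} {x : G}
    (hf : ∀ h ∈ H, f (h * x) = f x) :
    conv ((H : Set G).indicator 1) f x = Nat.card H * f x := by
  have := Fintype.ofFinite H
  rw [conv_indicator_apply, finsum_eq_sum_of_fintype, Finset.sum_congr rfl fun (h : H) _ => hf h h.2]
  simp

lemma le_leftPeriods_conv [Finite G] (H : Subgroup G) (f : G → ℂ) :
    H ≤ leftPeriods (conv ((H : Set G).indicator 1) f) := by
  have := Fintype.ofFinite H
  intro h hh x
  rw [conv_indicator_apply, conv_indicator_apply, finsum_eq_sum_of_fintype,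
    finsum_eq_sum_of_fintype]
  refine Fintype.sum_equiv (Equiv.mulRight ⟨h, hh⟩) _ _ fun k => ?_
  simp [mul_assoc]

lemma exists_eq_comp_mk {H : Subgroup G} [H.Normal] {f : G → ℂ} (hf : H ≤ leftPeriods f) :
    ∃ f' : G ⧸ H → ℂ, compHom (QuotientGroup.mk' H) f' = f := by
  refine ⟨fun q => f q.out, ?_⟩
  ext x
  obtain ⟨h, hh⟩ := QuotientGroup.mk_out_eq_mul H x
  change f ((x : G ⧸ H).out) = f x
  rw [hh]
  have := hf (‹H.Normal›.conj_mem h h.2 x) x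
  rwa [inv_mul_cancel_right] at this

lemma conv_comp_mk [Finite G] (H : Subgroup G) [H.Normal] (f h : G ⧸ H → ℂ) :
    conv (compHom (QuotientGroup.mk' H) f) (compHom (QuotientGroup.mk' H) h) =
      (Nat.card H : ℂ) • compHom (QuotientGroup.mk' H) (conv f h) := by
  classical
  have := Fintype.ofFinite G
  have := Fintype.ofFinite H
  have := Fintype.ofFinite (G ⧸ H)
  ext x
  rw [conv_apply, Pi.smul_apply, compHom_apply, conv_apply, smul_eq_mul]
  have key : ∀ F : G ⧸ H → ℂ, ∑ y : G, F y = Nat.card H * ∑ q, F q := by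
    intro F
    rw [Fintype.sum_equiv (Subgroup.groupEquivQuotientProdSubgroup (s := H)) (fun y : G => F y)
      (fun p => F p.1) (fun y => rfl), Fintype.sum_prod_type]
    simp [Finset.mul_sum]
  exact key fun q => f q * h (q⁻¹ * QuotientGroup.mk' H x)

end

namespace SupercharacterTheory

variable {G : Type*} [Group G] [Finite G] (S : SupercharacterTheory G)

/-! ### Restriction and deflation -/

variable {S} in
/-- The restriction of `S` to an `S`-normal subgroup `N`: its superclasses are those of `S` that
lie in `N`. -/
def restrict {N : Subgroup G} (hN : S.IsNormal N) : SupercharacterTheory N :=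
  ofSubalgebra (S.classFun.map (compHom (Subtype.val : N → G)))
    (by
      rintro _ ⟨f, hf, rfl⟩ x y
      exact S.isClassFun_of_mem hf x y)
    (by
      refine ⟨_, S.indicator_singleton_one_mem_classFun, ?_⟩
      ext x
      change ({1} : Set G).indicator 1 (x : G) = _
      by_cases hx : x = 1 <;> simp [hx])
    (by
      rintro _ ⟨f, hf, rfl⟩ _ ⟨h, hh, rfl⟩
      have h1 := S.isNormal_iff_indicator_mem.1 hN
      refine ⟨conv ((N : Set G).indicator 1 * f) h, S.conv_mem_classFun (mul_mem h1 hf) hh, ?_⟩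
      ext x
      change conv ((N : Set G).indicator 1 * f) h x = ∑ᶠ y : N, f y * h ((y : G)⁻¹ * x)
      rw [← finsum_indicator_mul N fun y => f y * h (y⁻¹ * x)]
      exact finsum_congr fun y => mul_assoc _ _ _)

lemma classFun_restrict {N : Subgroup G} (hN : S.IsNormal N) :
    (restrict hN).classFun = S.classFun.map (compHom (Subtype.val : N → G)) :=
  classFun_ofSubalgebra _ _ _ _

lemma mem_cls_restrict {N : Subgroup G} (hN : S.IsNormal N) {x y : N} :
    y ∈ (restrict hN).cls x ↔ (y : G) ∈ S.cls x := by
  rw [mem_cls, mem_cls, classFun_restrict]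
  constructor
  · intro h f hf
    exact h _ ⟨f, hf, rfl⟩
  · rintro h _ ⟨f, hf, rfl⟩
    exact h f hf

lemma image_cls_restrict {N : Subgroup G} (hN : S.IsNormal N) (x : N) :
    Subtype.val '' (restrict hN).cls x = S.cls x := by
  ext y
  constructor
  · rintro ⟨z, hz, rfl⟩
    exact (S.mem_cls_restrict hN).1 hz
  · intro hy
    exact ⟨⟨y, S.isNormal_iff.1 hN x x.2 y hy⟩, (S.mem_cls_restrict hN).2 hy, rfl⟩

variable {S} in
/-- The deflation of `S` to the quotient by an `S`-normal subgroup `H`: its superclasses are the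
images of those of `S`. -/
def deflate {H : Subgroup G} [H.Normal] (hH : S.IsNormal H) : SupercharacterTheory (G ⧸ H) :=
  ofSubalgebra (S.classFun.comap (compHom (QuotientGroup.mk' H)))
    (by
      intro f hf x y
      induction x using QuotientGroup.induction_on with | H x => ?_
      induction y using QuotientGroup.induction_on with | H y => ?_
      exact S.isClassFun_of_mem hf x y)
    (by
      have h1 := S.isNormal_iff_indicator_mem.1 hH
      rw [Subalgebra.mem_comap]
      convert h1 using 1
      ext x
      change ({1} : Set (G ⧸ H)).indicator 1 (x : G ⧸ H) = _
      by_cases hx : x ∈ H <;> simp [hx])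
    (by
      intro f hf h hh
      have hne : (Nat.card H : ℂ) ≠ 0 := by exact_mod_cast Nat.card_pos.ne'
      rw [Subalgebra.mem_comap] at hf hh ⊢
      have h1 := S.classFun.smul_mem (S.conv_mem_classFun hf hh) (Nat.card H : ℂ)⁻¹
      rwa [conv_comp_mk, inv_smul_smul₀ hne] at h1)

lemma mem_classFun_deflate {H : Subgroup G} [H.Normal] (hH : S.IsNormal H) {f : G ⧸ H → ℂ} :
    f ∈ (deflate hH).classFun ↔ compHom (QuotientGroup.mk' H) f ∈ S.classFun := by
  have h : (deflate hH).classFun = S.classFun.comap (compHom (QuotientGroup.mk' H)) :=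
    classFun_ofSubalgebra _ _ _ _
  rw [h, Subalgebra.mem_comap]

/-- If `1_K` is the indicator function of the superclass `K` of `x`, then `1_H * 1_K` descends to a
superclass function on `G ⧸ H` whose support is the image of `K`. -/
lemma cls_deflate {H : Subgroup G} [H.Normal] (hH : S.IsNormal H) (x : G) :
    (deflate hH).cls (QuotientGroup.mk' H x) = QuotientGroup.mk' H '' S.cls x := by
  classical
  have := Fintype.ofFinite H
  ext q
  constructor
  · intro hq
    obtain ⟨z, rfl⟩ := QuotientGroup.mk'_surjective H q
    let g := conv ((H : Set G).indicator 1) ((S.cls x).indicator 1)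
    have hg : g ∈ S.classFun :=
      S.conv_mem_classFun (S.isNormal_iff_indicator_mem.1 hH) (S.indicator_cls_mem x)
    obtain ⟨f, hf⟩ := exists_eq_comp_mk (le_leftPeriods_conv H ((S.cls x).indicator 1))
    have hfD : f ∈ (deflate hH).classFun := by
      rw [mem_classFun_deflate, hf]
      exact hg
    have h1 : g z = g x := by
      simp only [g]
      rw [← hf]
      exact hq f hfD
    -- `g w` counts the `h ∈ H` with `h * w` in the superclass of `x`.
    have hcount : ∀ w, g w = (Finset.univ.filter fun h : H => (h : G) * w ∈ S.cls x).card := by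
      intro w
      simp only [g]
      rw [conv_indicator_apply, finsum_eq_sum_of_fintype, Finset.card_filter]
      simp [Set.indicator_apply]
    rw [hcount, hcount, Nat.cast_inj] at h1
    have h2 : (Finset.univ.filter fun h : H => (h : G) * x ∈ S.cls x).Nonempty :=
      ⟨1, by simpa using S.mem_cls_self x⟩
    rw [← Finset.card_pos, ← h1, Finset.card_pos] at h2
    obtain ⟨h, hh⟩ := h2
    refine ⟨h * z, (Finset.mem_filter.1 hh).2, ?_⟩
    have : QuotientGroup.mk' H (h : G) = 1 := by simp
    rw [map_mul, this, one_mul]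
  · rintro ⟨y, hy, rfl⟩ f hf
    exact hy _ ((S.mem_classFun_deflate hH).1 hf)

end SupercharacterTheory

/-! ### Vanishing-off subgroups and products -/

namespace SupercharacterTheory

variable {G : Type*} [Group G] {S : SupercharacterTheory G}

lemma V_le_iff {H N : Subgroup G} :
    S.V H ≤ N ↔ ∀ σ ∈ S.supercharactersOver H, ∀ x ∉ N, σ x = 0 := by
  rw [V, Subgroup.closure_le]
  constructor
  · intro h σ hσ x hx
    by_contra h0
    exact hx (h ⟨σ, hσ, h0⟩)
  · rintro h x ⟨σ, hσ, h0⟩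
    by_contra hx
    exact h0 (h σ hσ x hx)

/-- If each superclass lies in `N` or is a union of cosets of `H`, then superclasses outside `N` are
closed under translation by `H`. -/
lemma mul_mem_cls_of_forall {H N : Subgroup G} [H.Normal]
    (hS : ∀ K ∈ S.superclasses, K ⊆ N ∨ ∃ L, K = QuotientGroup.mk' H ⁻¹' L) :
    ∀ x ∉ N, ∀ h ∈ H, h * x ∈ S.cls x := by
  intro x hx h hh
  have hxx := S.mem_cls_self x
  obtain hK | ⟨L, hL⟩ := hS (S.cls x) (S.mem_superclasses_iff.2 ⟨x, rfl⟩)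
  · exact absurd (hK hxx) hx
  · rw [hL] at hxx ⊢
    have h1 : QuotientGroup.mk' H h = 1 := by simpa using hh
    rwa [Set.mem_preimage, map_mul, h1, one_mul]

variable [Finite G]

lemma classFun_le_span (S : SupercharacterTheory G) :
    Subalgebra.toSubmodule S.classFun ≤ Submodule.span ℂ S.supercharacters := by
  have hG : (Nat.card G : ℂ) ≠ 0 := by exact_mod_cast Nat.card_pos.ne'
  rw [← map_ofCentralChar, Submodule.map_le_iff_le_comap]
  intro p hp
  refine Submodule.span_le.2 ?_ (mem_span_indicator S.charParts_isPartition hp)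
  rintro _ ⟨X, hX, rfl⟩
  have h1 : sigmaChar X ∈ Submodule.span ℂ S.supercharacters :=
    Submodule.subset_span ⟨X, hX, rfl⟩
  rw [sigmaChar_eq] at h1
  have h2 := Submodule.smul_mem _ (Nat.card G : ℂ)⁻¹ h1
  rwa [inv_smul_smul₀ hG] at h2

/-- Supercharacters separate superclasses. -/
lemma mem_cls_of_supercharacters {x y : G} (h : ∀ σ ∈ S.supercharacters, σ y = σ x) :
    y ∈ S.cls x := by
  intro f hf
  have hle : Submodule.span ℂ S.supercharacters ≤
      LinearMap.eqLocus (LinearMap.proj (R := ℂ) (φ := fun _ : G => ℂ) y) (LinearMap.proj x) :=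
    Submodule.span_le.2 h
  exact hle (S.classFun_le_span hf)

lemma supercharacter_one_ne_zero {σ : G → ℂ} (hσ : σ ∈ S.supercharacters) : σ 1 ≠ 0 := by
  obtain ⟨X, hX, rfl⟩ := hσ
  exact sigmaChar_one_ne_zero (Setoid.nonempty_of_mem_partition S.charParts_isPartition hX)

/-- The scalar `c` by which convolution with `1_H` acts on a supercharacter satisfies
`c² = |H| c`. -/
lemma le_leftPeriods_or_conv_eq_zero {H : Subgroup G} (hH : S.IsNormal H) {σ : G → ℂ}
    (hσ : σ ∈ S.supercharacters) :
    H ≤ leftPeriods σ ∨ conv ((H : Set G).indicator 1) σ = 0 := by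
  have h1 := supercharacter_one_ne_zero hσ
  obtain ⟨c, hc⟩ : ∃ c : ℂ, conv ((H : Set G).indicator 1) σ = c • σ := by
    obtain ⟨X, hX, rfl⟩ := hσ
    exact S.exists_conv_sigmaChar (S.isNormal_iff_indicator_mem.1 hH) hX
  have hle := le_leftPeriods_conv H σ
  by_cases hc0 : c = 0
  · right
    rw [hc, hc0, zero_smul]
  · left
    intro h hh x
    have := hle hh x
    rw [hc, Pi.smul_apply, Pi.smul_apply, smul_eq_mul, smul_eq_mul] at this
    exact mul_left_cancel₀ hc0 this

lemma subset_charKer_iff {H : Subgroup G} (hH : S.IsNormal H) {σ : G → ℂ}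
    (hσ : σ ∈ S.supercharacters) : (H : Set G) ⊆ charKer σ ↔ H ≤ leftPeriods σ := by
  constructor
  · intro hker
    refine (le_leftPeriods_or_conv_eq_zero hH hσ).resolve_right fun h0 => ?_
    have h1 := conv_indicator_eq_card_mul (H := H) (f := σ) (x := 1) fun h hh => by
      rw [mul_one]; exact hker hh
    rw [h0, Pi.zero_apply, eq_comm, mul_eq_zero] at h1
    exact h1.elim (by exact_mod_cast Nat.card_pos.ne') (supercharacter_one_ne_zero hσ)
  · intro h x hx
    have := h hx 1
    rwa [mul_one] at this

/-- If `k ∈ H` lies outside `V(S | H)`, then `1_H * σ` and `|H| σ` agree at `k` for every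
supercharacter `σ`, hence `1_H * f` and `|H| f` do for every superclass function `f`. For `f` the
indicator function of `{1}` this forces `k = 1`. -/
lemma le_V {H : Subgroup G} (hH : S.IsNormal H) : H ≤ S.V H := by
  intro k hk
  by_contra hkV
  have hk1 : k ≠ 1 := by
    rintro rfl
    exact hkV (one_mem _)
  let L : (G → ℂ) →ₗ[ℂ] ℂ := LinearMap.proj k ∘ₗ convLin ((H : Set G).indicator 1)
  let R : (G → ℂ) →ₗ[ℂ] ℂ := (Nat.card H : ℂ) • LinearMap.proj k
  have hle : Submodule.span ℂ S.supercharacters ≤ LinearMap.eqLocus L R := by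
    refine Submodule.span_le.2 fun σ hσ => ?_
    change conv ((H : Set G).indicator 1) σ k = Nat.card H * σ k
    by_cases hker : (H : Set G) ⊆ charKer σ
    · rw [subset_charKer_iff hH hσ] at hker
      exact conv_indicator_eq_card_mul fun h hh => hker hh k
    · have h0 : σ k = 0 := V_le_iff.1 le_rfl σ ⟨hσ, hker⟩ k hkV
      rw [subset_charKer_iff hH hσ] at hker
      rw [(le_leftPeriods_or_conv_eq_zero hH hσ).resolve_left hker, h0, mul_zero]
      rfl
  have h1 : conv ((H : Set G).indicator 1) (({1} : Set G).indicator 1) k =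
      Nat.card H * ({1} : Set G).indicator 1 k :=
    hle (S.classFun_le_span S.indicator_singleton_one_mem_classFun)
  have h2 : (∑ᶠ h : H, ({1} : Set G).indicator (1 : G → ℂ) (h * k)) = 1 := by
    rw [finsum_eq_single _ (⟨k, hk⟩⁻¹ : H)]
    · simp
    · intro h hne
      rw [Set.indicator_of_notMem]
      intro h3
      exact hne (eq_inv_of_mul_eq_one_left (Subtype.ext h3))
  rw [conv_indicator_apply, h2, Set.indicator_of_notMem (by simpa using hk1), mul_zero] at h1
  exact one_ne_zero h1

/-- `V(S | H) ≤ N` means that `S` is coarse outside `N`: superclasses there are unions of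
cosets of `H`. -/
lemma V_le_iff_forall_mul_mem_cls {H N : Subgroup G} (hH : S.IsNormal H) :
    S.V H ≤ N ↔ H ≤ N ∧ ∀ x ∉ N, ∀ h ∈ H, h * x ∈ S.cls x := by
  constructor
  · intro hV
    have hHN : H ≤ N := (le_V hH).trans hV
    refine ⟨hHN, fun x hx h hh => mem_cls_of_supercharacters fun σ hσ => ?_⟩
    by_cases hker : (H : Set G) ⊆ charKer σ
    · exact (subset_charKer_iff hH hσ).1 hker hh x
    · have hx' : h * x ∉ N := by rwa [N.mul_mem_cancel_left (hHN hh)]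
      rw [V_le_iff.1 hV σ ⟨hσ, hker⟩ x hx, V_le_iff.1 hV σ ⟨hσ, hker⟩ _ hx']
  · rintro ⟨-, h⟩
    refine V_le_iff.2 fun σ ⟨hσ, hker⟩ x hx => ?_
    rw [subset_charKer_iff hH hσ] at hker
    have hmem : σ ∈ S.classFun := by
      obtain ⟨X, hX, rfl⟩ := hσ
      exact S.sigmaChar_mem_classFun hX
    have h1 := conv_indicator_eq_card_mul fun k hk => h x hx k hk σ hmem
    rw [(le_leftPeriods_or_conv_eq_zero hH hσ).resolve_left hker, Pi.zero_apply, eq_comm,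
      mul_eq_zero] at h1
    exact h1.resolve_left (by exact_mod_cast Nat.card_pos.ne')

lemma U_le (N : Subgroup G) : S.U N ≤ N :=
  sSup_le fun _ ⟨hK, hV⟩ => (le_V hK).trans hV

/-- A supercharacter whose left periods contain every `S`-normal `K` with `V(S | K) ≤ N` has `U(S | N)`
among its left periods. -/
lemma le_U_iff {H N : Subgroup G} (hH : S.IsNormal H) : H ≤ S.U N ↔ S.V H ≤ N := by
  constructor
  · intro hU
    refine V_le_iff.2 fun σ ⟨hσ, hker⟩ x hx => ?_
    rw [subset_charKer_iff hH hσ] at hker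
    by_contra h0
    refine hker (hU.trans (sSup_le fun K ⟨hK, hV⟩ => ?_))
    rw [← subset_charKer_iff hK hσ]
    by_contra hker'
    exact h0 (V_le_iff.1 hV σ ⟨hσ, hker'⟩ x hx)
  · exact fun hV => le_sSup ⟨hH, hV⟩

lemma isDeltaProduct_restrict_deflate {H N : Subgroup G} [H.Normal] (hH : S.IsNormal H)
    (hN : S.IsNormal N) (hHN : H ≤ N) (hcls : ∀ x ∉ N, ∀ h ∈ H, h * x ∈ S.cls x) :
    S.IsDeltaProduct (restrict hN) (deflate hH) := by
  have hmap : ∀ x : G, QuotientGroup.mk' H x ∈ N.map (QuotientGroup.mk' H) ↔ x ∈ N := by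
    intro x
    rw [← Subgroup.mem_comap, Subgroup.comap_map_eq_self]
    simpa using hHN
  have himage : ∀ n : N, (fun m : N => QuotientGroup.mk' H (m : G)) '' (restrict hN).cls n =
      (deflate hH).cls (QuotientGroup.mk' H n) := by
    intro n
    rw [cls_deflate, ← image_cls_restrict S hN, Set.image_image]
  have hpre : ∀ x ∉ N, QuotientGroup.mk' H ⁻¹' (deflate hH).cls (QuotientGroup.mk' H x) =
      S.cls x := by
    intro x hx
    rw [cls_deflate]
    refine Set.Subset.antisymm ?_ (Set.subset_preimage_image _ _)
    rintro z ⟨y, hy, hyz⟩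
    have hyN : y ∉ N := fun h => hx (S.isNormal_iff.1 hN y h x (by
      rw [S.cls_eq hy]; exact S.mem_cls_self x))
    have h1 : z * y⁻¹ ∈ H := by
      rw [← QuotientGroup.ker_mk' H, MonoidHom.mem_ker, map_mul, map_inv, hyz, mul_inv_cancel]
    have h2 := hcls y hyN _ h1
    rwa [inv_mul_cancel_right, S.cls_eq hy] at h2
  refine ⟨?_, ?_, ?_, ?_, ?_⟩
  · intro K hK n hn m hnm
    obtain ⟨k, rfl⟩ := (restrict hN).mem_superclasses_iff.1 hK
    obtain ⟨c, hc⟩ := isConj_iff.1 hnm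
    rw [mem_cls_restrict] at hn ⊢
    rw [← S.cls_eq hn, ← hc]
    exact S.conj_mem_cls _ _
  · rw [isNormal_iff]
    intro x hx y hy
    rw [Subgroup.mem_subgroupOf] at hx ⊢
    exact S.isNormal_iff.1 hH x hx y ((S.mem_cls_restrict hN).1 hy)
  · rw [isNormal_iff]
    intro q hq r hr
    obtain ⟨n, hn, rfl⟩ := hq
    rw [cls_deflate] at hr
    obtain ⟨y, hy, rfl⟩ := hr
    exact (hmap y).2 (S.isNormal_iff.1 hN n hn y hy)
  · ext L
    constructor
    · rintro ⟨K, hK, rfl⟩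
      obtain ⟨n, rfl⟩ := (restrict hN).mem_superclasses_iff.1 hK
      refine ⟨?_, ?_⟩
      · exact (deflate hH).mem_superclasses_iff.2 ⟨_, himage n⟩
      · rintro _ ⟨m, -, rfl⟩
        exact (hmap m).2 m.2
    · rintro ⟨hL, hLN⟩
      obtain ⟨q, rfl⟩ := (deflate hH).mem_superclasses_iff.1 hL
      obtain ⟨x, rfl⟩ := QuotientGroup.mk'_surjective H q
      have hx : x ∈ N := (hmap x).1 (hLN (mem_cls_self _ _))
      exact ⟨_, (restrict hN).mem_superclasses_iff.2 ⟨⟨x, hx⟩, rfl⟩, (himage ⟨x, hx⟩).symm⟩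
  · ext K
    constructor
    · intro hK
      obtain ⟨x, rfl⟩ := S.mem_superclasses_iff.1 hK
      by_cases hx : x ∈ N
      · exact Or.inl ⟨_, (restrict hN).mem_superclasses_iff.2 ⟨⟨x, hx⟩, rfl⟩,
          (image_cls_restrict S hN ⟨x, hx⟩).symm⟩
      · refine Or.inr ⟨_, (deflate hH).mem_superclasses_iff.2 ⟨QuotientGroup.mk' H x, rfl⟩, ?_,
          (hpre x hx).symm⟩
        rw [Set.disjoint_left, cls_deflate]
        rintro _ ⟨y, hy, rfl⟩ hyN
        refine hx (S.isNormal_iff.1 hN y ((hmap y).1 hyN) x ?_)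
        rw [S.cls_eq hy]
        exact S.mem_cls_self x
    · rintro (⟨L, hL, rfl⟩ | ⟨L, hL, hdisj, rfl⟩)
      · obtain ⟨n, rfl⟩ := (restrict hN).mem_superclasses_iff.1 hL
        exact S.mem_superclasses_iff.2 ⟨n, image_cls_restrict S hN n⟩
      · obtain ⟨q, rfl⟩ := (deflate hH).mem_superclasses_iff.1 hL
        obtain ⟨x, rfl⟩ := QuotientGroup.mk'_surjective H q
        have hx : x ∉ N := fun hx =>
          Set.disjoint_left.1 hdisj (mem_cls_self _ _) ((hmap x).2 hx)
        exact S.mem_superclasses_iff.2 ⟨x, hpre x hx⟩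

lemma isDeltaProductOver_iff {H N : Subgroup G} (hH : S.IsNormal H) (hN : S.IsNormal N) :
    S.IsDeltaProductOver H N ↔ H ≤ N ∧ ∀ x ∉ N, ∀ h ∈ H, h * x ∈ S.cls x := by
  constructor
  · rintro ⟨hHN, -, _, C, D, -, -, -, -, hS⟩
    refine ⟨hHN, mul_mem_cls_of_forall fun K hK => ?_⟩
    rw [hS] at hK
    obtain ⟨L, -, rfl⟩ | ⟨L, -, -, rfl⟩ := hK
    · left
      rintro _ ⟨n, -, rfl⟩
      exact n.2
    · exact Or.inr ⟨L, rfl⟩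
  · rintro ⟨hHN, h⟩
    have := hH.normal
    exact ⟨hHN, hN.normal, this, _, _, isDeltaProduct_restrict_deflate hH hN hHN h⟩

lemma isStarProductOver_iff {N : Subgroup G} (hN : S.IsNormal N) :
    S.IsStarProductOver N ↔ ∀ x ∉ N, ∀ h ∈ N, h * x ∈ S.cls x := by
  constructor
  · rintro ⟨_, C, D, -, hS⟩
    refine mul_mem_cls_of_forall fun K hK => ?_
    rw [hS] at hK
    obtain ⟨L, -, rfl⟩ | ⟨L, -, -, rfl⟩ := hK
    · left
      rintro _ ⟨n, -, rfl⟩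
      exact n.2
    · exact Or.inr ⟨L, rfl⟩
  · intro h
    have := hN.normal
    obtain ⟨hinv, -, -, -, hS⟩ := isDeltaProduct_restrict_deflate hN hN le_rfl h
    refine ⟨this, restrict hN, deflate hN, hinv, hS.trans ?_⟩
    -- In the quotient by `N` the image of `N` is the superclass `{1}`.
    have hdisj : ∀ L ∈ (deflate hN).superclasses,
        Disjoint L (N.map (QuotientGroup.mk' N) : Set (G ⧸ N)) ↔ L ≠ {1} := by
      intro L hL
      have hmap : N.map (QuotientGroup.mk' N) = ⊥ := by
        rw [Subgroup.map_eq_bot_iff, QuotientGroup.ker_mk']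
      rw [hmap, Subgroup.coe_bot]
      constructor
      · rintro hd rfl
        simp at hd
      · exact (deflate hN).superclasses_isPartition.pairwiseDisjoint hL
          (deflate hN).singleton_one_mem
    congr 1
    ext K
    constructor
    · rintro ⟨L, hL, hd, hK⟩
      exact ⟨L, hL, (hdisj L hL).1 hd, hK⟩
    · rintro ⟨L, hL, hd, hK⟩
      exact ⟨L, hL, (hdisj L hL).2 hd, hK⟩

end SupercharacterTheory

theorem theorem3 {G : Type*} [Group G] [Finite G] (S : SupercharacterTheory G)
    (H N : Subgroup G) (hH : S.IsNormal H) (hN : S.IsNormal N) :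
    (H ≤ S.U N ↔ S.IsDeltaProductOver H N) ∧
      (N = S.U N ↔ S.IsStarProductOver N) := by
  have hN' : N = S.U N ↔ N ≤ S.U N :=
    ⟨fun h => h.le, fun h => le_antisymm h (SupercharacterTheory.U_le N)⟩
  constructor
  · rw [SupercharacterTheory.le_U_iff hH, SupercharacterTheory.V_le_iff_forall_mul_mem_cls hH,
      SupercharacterTheory.isDeltaProductOver_iff hH hN]
  · rw [hN', SupercharacterTheory.le_U_iff hN,
      SupercharacterTheory.V_le_iff_forall_mul_mem_cls hN,
      SupercharacterTheory.isStarProductOver_iff hN, and_iff_right le_rfl]
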